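/- Let $p>1$, $0<h\le 1$ with $ph>1$. There is a constant $C_{p,h}>0$, depending only on $p$ and $h$, such that the following holds. Let $(\Omega,\mathcal F,\{\mathcal F_t\}_{t\ge0},\mathbb P)$ be a filtered probability space satisfying the usual conditions. Let $T>0$, $d\in\mathbb N$, and let $\{X_t\}_{t\in[0,T]}$ be a continuous $\{\mathcal F_t\}$-adapted $\mathbb R^d$-valued process with $X_t\in L^p(\Omega;\mathbb R^d)$ for all $t\in[0,T]$ which satisfies the conditional increment control $$\mathbb E\left[\left|\mathbb E(X_t\mid\mathcal F_s)-X_s\right|^p\right]\le A_{p,h}\,|t-s|^{ph}\qquad\text{for all }0\le s<t\le T,$$ with a constant $A_{p,h}\ge0$ independent of $s$ and $t$. Let $0\le s_0<t_0\le T$ and $X^*=\sup_{u\in[s_0,t_0]}|X_u|$. Then for every $1<q\le p$, $$\|X^*\|_{L^q}\le\frac{q}{q-1}\left[C_{p,h}^{1/p}A_{p,h}^{1/p}|t_0-s_0|^h+\|X_{t_0}\|_{L^q}\right].$$ -/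

import Mathlib

open MeasureTheory ProbabilityTheory
open scoped NNReal ENNReal

/-- The usual conditions for a filtration indexed by `[0, ∞)`: right-continuity, and the initial
σ-algebra contains every subset of every `P`-null set (so that `P` is complete as well). -/
structure UsualConditions {Ω : Type*} {m : MeasurableSpace Ω} (P : Measure Ω)
    (ℱ : Filtration ℝ≥0 m) : Prop where
  rightContinuous : ℱ.IsRightContinuous
  null_measurable : ∀ N : Set Ω, P N = 0 → MeasurableSet[ℱ 0] N

/-- A process on `[0, T]` that is adapted to `ℱ` and has (almost surely) continuous paths.
Only the values `X t` with `t ≤ T` matter. -/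
structure IsContinuousAdapted {Ω : Type*} {m : MeasurableSpace Ω} {d : ℕ} (P : Measure Ω)
    (ℱ : Filtration ℝ≥0 m) (T : ℝ≥0) (X : ℝ≥0 → Ω → EuclideanSpace ℝ (Fin d)) : Prop where
  adapted : ∀ t ≤ T, Measurable[ℱ t] (X t)
  continuous : ∀ᵐ ω ∂P, ContinuousOn (fun t => X t ω) (Set.Icc 0 T)

/-- The conditional increment control with parameter `(p, h)` and constant `A` on `[0, T]`:
`X t ∈ L^p` for all `t ∈ [0, T]`, and `E |E(X t | ℱ s) - X s| ^ p ≤ A |t - s| ^ (p h)` for all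
`0 ≤ s < t ≤ T`. The expectation of the nonnegative variable is a Lebesgue integral in
`[0, ∞]`. -/
structure ConditionalIncrementControl {Ω : Type*} {m : MeasurableSpace Ω} {d : ℕ} (P : Measure Ω)
    (ℱ : Filtration ℝ≥0 m) (T : ℝ≥0) (X : ℝ≥0 → Ω → EuclideanSpace ℝ (Fin d))
    (p h A : ℝ) : Prop where
  memLp : ∀ t ≤ T, MemLp (X t) (ENNReal.ofReal p) P
  nonneg : 0 ≤ A
  bound : ∀ s t : ℝ≥0, s < t → t ≤ T →
    ∫⁻ ω, ‖(P[X t | ℱ s]) ω - X s ω‖ₑ ^ p ∂P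
      ≤ ENNReal.ofReal (A * |(t : ℝ) - (s : ℝ)| ^ (p * h))

/-- The running supremum `sup_{u ∈ [s₀, t₀]} |X u|`, with values in `[0, ∞]`. -/
noncomputable def runningSup {Ω : Type*} {d : ℕ} (X : ℝ≥0 → Ω → EuclideanSpace ℝ (Fin d))
    (s₀ t₀ : ℝ≥0) (ω : Ω) : ℝ≥0∞ :=
  ⨆ u ∈ Set.Icc s₀ t₀, ‖X u ω‖ₑ

/-!
Let `V_n` be the `ℓ^p` norm of the conditional increments of `X` between neighbouring points of the
`n`-th dyadic subdivision of `[a, b]`. Summing the increment control over the `2 ^ n` intervals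
gives `‖V_n‖_p ≤ 2 ^ (n (1 / p - h)) A ^ (1 / p) (b - a) ^ h`, which is summable as `p h > 1`.
Walking from a dyadic point `t` to `b` takes at most one step per level, so the tower property
yields `|E(X_b | ℱ_t) - X_t| ≤ E(∑ V_n | ℱ_t)`. Hence along each subdivision `|X_t|` is dominated
by the martingale closed by `|X_b| + ∑ V_n`, to which Doob's `L^q` inequality applies. Monotone
convergence over the levels and continuity of the paths give the full supremum.
-/

section MaximalFunction

variable {Ω : Type*} {m : MeasurableSpace Ω} {μ : Measure Ω} {q : ℝ}

theorem eLpNorm_ofReal_eq_lintegral_rpow_enorm {ε : Type*} [TopologicalSpace ε] [ContinuousENorm ε]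
    (hq : 0 < q) (f : Ω → ε) :
    eLpNorm f (ENNReal.ofReal q) μ = (∫⁻ ω, ‖f ω‖ₑ ^ q ∂μ) ^ (1 / q) := by
  rw [eLpNorm_eq_lintegral_rpow_enorm_toReal (by simpa using hq) ENNReal.ofReal_ne_top,
    ENNReal.toReal_ofReal hq.le]

theorem eLpNorm_ofReal_rpow_eq_lintegral {ε : Type*} [TopologicalSpace ε] [ContinuousENorm ε]
    (hq : 0 < q) (f : Ω → ε) :
    eLpNorm f (ENNReal.ofReal q) μ ^ q = ∫⁻ ω, ‖f ω‖ₑ ^ q ∂μ := by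
  rw [eLpNorm_ofReal_eq_lintegral_rpow_enorm hq, ← ENNReal.rpow_mul, one_div_mul_cancel hq.ne',
    ENNReal.rpow_one]

theorem eLpNorm_iSup_of_monotone {p : ℝ≥0∞} (hp : p ≠ ∞) {f : ℕ → Ω → ℝ≥0∞}
    (hf : ∀ n, AEMeasurable (f n) μ) (hmono : ∀ᵐ ω ∂μ, Monotone fun n => f n ω) :
    eLpNorm (fun ω => ⨆ n, f n ω) p μ = ⨆ n, eLpNorm (f n) p μ := by
  rcases eq_or_ne p 0 with rfl | hp0
  · simp
  have hr : 0 < p.toReal := ENNReal.toReal_pos hp0 hp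
  have iSup_rpow : ∀ {r : ℝ}, 0 < r → ∀ u : ℕ → ℝ≥0∞, (⨆ n, u n) ^ r = ⨆ n, u n ^ r :=
    fun hr u => (ENNReal.orderIsoRpow _ hr).map_iSup u
  simp_rw [eLpNorm_eq_lintegral_rpow_enorm_toReal hp0 hp, enorm_eq_self, iSup_rpow hr]
  rw [lintegral_iSup' (fun n => (hf n).pow_const _), iSup_rpow (one_div_pos.2 hr)]
  filter_upwards [hmono] with ω hω i j hij
  exact ENNReal.rpow_le_rpow (hω hij) hr.le

theorem lintegral_rpow_sub_one_mul_le {E F : Type*} [TopologicalSpace E] [ContinuousENorm E]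
    [TopologicalSpace F] [ContinuousENorm F] (hq : 1 < q) {f : Ω → E} {g : Ω → F}
    (hf : AEStronglyMeasurable f μ) (hg : AEStronglyMeasurable g μ) :
    ∫⁻ ω, ‖f ω‖ₑ ^ (q - 1) * ‖g ω‖ₑ ∂μ
      ≤ eLpNorm f (ENNReal.ofReal q) μ ^ (q - 1) * eLpNorm g (ENNReal.ofReal q) μ := by
  have hq0 : 0 < q := by linarith
  have hq1 : q - 1 ≠ 0 := by linarith
  have hconj : (q / (q - 1)).HolderConjugate q := (Real.HolderConjugate.conjExponent hq).symm
  calc ∫⁻ ω, ‖f ω‖ₑ ^ (q - 1) * ‖g ω‖ₑ ∂μ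
      ≤ (∫⁻ ω, (‖f ω‖ₑ ^ (q - 1)) ^ (q / (q - 1)) ∂μ) ^ (1 / (q / (q - 1))) *
          (∫⁻ ω, ‖g ω‖ₑ ^ q ∂μ) ^ (1 / q) :=
        ENNReal.lintegral_mul_le_Lp_mul_Lq μ hconj (hf.enorm.pow_const _) hg.enorm
    _ = eLpNorm f (ENNReal.ofReal q) μ ^ (q - 1) * eLpNorm g (ENNReal.ofReal q) μ := by
        simp_rw [← ENNReal.rpow_mul, mul_div_cancel₀ q hq1]
        rw [← eLpNorm_ofReal_rpow_eq_lintegral hq0, ← ENNReal.rpow_mul,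
          ← eLpNorm_ofReal_eq_lintegral_rpow_enorm hq0, one_div_div, mul_div_cancel₀ _ hq0.ne']

/-- Layer-cake formula, applied once to `μ` and once to the measure with density `g`. -/
theorem lintegral_rpow_le_of_mul_meas_ge_le_setLIntegral (hq : 1 < q) {f : Ω → ℝ}
    {g : Ω → ℝ≥0∞} (hf : Measurable f) (hf0 : 0 ≤ f) (hg : AEMeasurable g μ)
    (hfg : ∀ t : ℝ, 0 < t →
      ENNReal.ofReal t * μ {ω | t ≤ f ω} ≤ ∫⁻ ω in {ω | t ≤ f ω}, g ω ∂μ) :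
    ∫⁻ ω, ‖f ω‖ₑ ^ q ∂μ ≤ ENNReal.ofReal (q / (q - 1)) * ∫⁻ ω, ‖f ω‖ₑ ^ (q - 1) * g ω ∂μ := by
  have hq0 : 0 < q := by linarith
  have hq1 : 0 < q - 1 := by linarith
  have layercake : ∀ (ν : Measure Ω) {r : ℝ}, 0 < r → ∫⁻ ω, ‖f ω‖ₑ ^ r ∂ν =
      ENNReal.ofReal r * ∫⁻ t in Set.Ioi 0, ν {ω | t ≤ f ω} * ENNReal.ofReal (t ^ (r - 1)) := by
    intro ν r hr
    rw [← lintegral_rpow_eq_lintegral_meas_le_mul ν (.of_forall hf0) hf.aemeasurable hr]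
    refine lintegral_congr fun ω => ?_
    rw [Real.enorm_of_nonneg (hf0 ω), ENNReal.ofReal_rpow_of_nonneg (hf0 ω) hr.le]
  have layercake_density : ∫⁻ ω, ‖f ω‖ₑ ^ (q - 1) * g ω ∂μ = ENNReal.ofReal (q - 1) *
      ∫⁻ t in Set.Ioi 0, (∫⁻ ω in {ω | t ≤ f ω}, g ω ∂μ) * ENNReal.ofReal (t ^ (q - 1 - 1)) := by
    simp_rw [← withDensity_apply g (measurableSet_le measurable_const hf)]
    rw [← layercake _ hq1, lintegral_withDensity_eq_lintegral_mul₀ hg (by fun_prop)]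
    simp only [Pi.mul_apply, mul_comm]
  have weak_type : ∀ t ∈ Set.Ioi (0 : ℝ), μ {ω | t ≤ f ω} * ENNReal.ofReal (t ^ (q - 1)) ≤
      (∫⁻ ω in {ω | t ≤ f ω}, g ω ∂μ) * ENNReal.ofReal (t ^ (q - 1 - 1)) := by
    intro t (ht : 0 < t)
    calc μ {ω | t ≤ f ω} * ENNReal.ofReal (t ^ (q - 1))
        = ENNReal.ofReal t * μ {ω | t ≤ f ω} * ENNReal.ofReal (t ^ (q - 1 - 1)) := by
          rw [Real.rpow_sub_one ht.ne' (q - 1), mul_right_comm, ← ENNReal.ofReal_mul ht.le,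
            mul_div_cancel₀ _ ht.ne', mul_comm]
      _ ≤ _ := by gcongr; exact hfg t ht
  calc ∫⁻ ω, ‖f ω‖ₑ ^ q ∂μ
      = ENNReal.ofReal q *
          ∫⁻ t in Set.Ioi 0, μ {ω | t ≤ f ω} * ENNReal.ofReal (t ^ (q - 1)) := layercake μ hq0
    _ ≤ ENNReal.ofReal q * ∫⁻ t in Set.Ioi 0,
          (∫⁻ ω in {ω | t ≤ f ω}, g ω ∂μ) * ENNReal.ofReal (t ^ (q - 1 - 1)) := by
        gcongr 1
        exact setLIntegral_mono_ae' measurableSet_Ioi (.of_forall weak_type)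
    _ = ENNReal.ofReal (q / (q - 1)) * ∫⁻ ω, ‖f ω‖ₑ ^ (q - 1) * g ω ∂μ := by
        rw [layercake_density, ← mul_assoc, ← ENNReal.ofReal_mul (by positivity),
          div_mul_cancel₀ q hq1.ne']

theorem eLpNorm_le_of_mul_meas_ge_le_setLIntegral {E : Type*} [TopologicalSpace E]
    [ContinuousENorm E] (hq : 1 < q) {f : Ω → ℝ} {g : Ω → E} (hf : Measurable f) (hf0 : 0 ≤ f)
    (hfq : MemLp f (ENNReal.ofReal q) μ) (hg : AEStronglyMeasurable g μ)
    (hfg : ∀ t : ℝ, 0 < t →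
      ENNReal.ofReal t * μ {ω | t ≤ f ω} ≤ ∫⁻ ω in {ω | t ≤ f ω}, ‖g ω‖ₑ ∂μ) :
    eLpNorm f (ENNReal.ofReal q) μ
      ≤ ENNReal.ofReal (q / (q - 1)) * eLpNorm g (ENNReal.ofReal q) μ := by
  have hq0 : 0 < q := by linarith
  rcases eq_or_ne (eLpNorm f (ENNReal.ofReal q) μ) 0 with hN | hN
  · exact hN.trans_le zero_le
  have hN_top : eLpNorm f (ENNReal.ofReal q) μ ≠ ∞ := hfq.eLpNorm_ne_top
  set N := eLpNorm f (ENNReal.ofReal q) μ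
  have key : N ^ (q - 1) * N
      ≤ N ^ (q - 1) * (ENNReal.ofReal (q / (q - 1)) * eLpNorm g (ENNReal.ofReal q) μ) := by
    calc N ^ (q - 1) * N
        = ∫⁻ ω, ‖f ω‖ₑ ^ q ∂μ := by
          rw [← eLpNorm_ofReal_rpow_eq_lintegral hq0, ENNReal.rpow_sub _ _ hN hN_top,
            ENNReal.rpow_one, ENNReal.div_mul_cancel hN hN_top]
      _ ≤ ENNReal.ofReal (q / (q - 1)) * ∫⁻ ω, ‖f ω‖ₑ ^ (q - 1) * ‖g ω‖ₑ ∂μ :=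
          lintegral_rpow_le_of_mul_meas_ge_le_setLIntegral hq hf hf0 hg.enorm hfg
      _ ≤ ENNReal.ofReal (q / (q - 1)) *
            (N ^ (q - 1) * eLpNorm g (ENNReal.ofReal q) μ) := by
          gcongr
          exact lintegral_rpow_sub_one_mul_le hq hfq.1 hg
      _ = _ := mul_left_comm _ _ _
  exact (ENNReal.mul_le_mul_iff_right (by simp [hN, hN_top]) (by finiteness)).1 key

end MaximalFunction

section Doob

variable {Ω : Type*} {m : MeasurableSpace Ω} {μ : Measure Ω} [IsFiniteMeasure μ]
  {𝒢 : Filtration ℕ m} {q : ℝ}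

theorem eLpNorm_sup'_le_of_submartingale (hq : 1 < q) {f : ℕ → Ω → ℝ} (hsub : Submartingale f 𝒢 μ)
    (hf0 : 0 ≤ f) {n : ℕ} (hfn : MemLp (f n) (ENNReal.ofReal q) μ) :
    eLpNorm (fun ω => (Finset.range (n + 1)).sup' Finset.nonempty_range_add_one fun k => f k ω)
        (ENNReal.ofReal q) μ
      ≤ ENNReal.ofReal (q / (q - 1)) * eLpNorm (f n) (ENNReal.ofReal q) μ := by
  have hmeas : ∀ k, Measurable (f k) := fun k =>
    ((hsub.stronglyMeasurable k).mono (𝒢.le k)).measurable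
  have hmemLp : ∀ k ∈ Finset.range (n + 1), MemLp (f k) (ENNReal.ofReal q) μ := fun k hk => by
    refine (hfn.condExp (m := 𝒢 k) (by simpa using hq.le)).mono'
      (hmeas k).aestronglyMeasurable ?_
    filter_upwards [hsub.ae_le_condExp (Finset.mem_range_succ_iff.1 hk)] with ω hω
    rwa [Real.norm_of_nonneg (hf0 k ω)]
  set F : Ω → ℝ := fun ω =>
    (Finset.range (n + 1)).sup' Finset.nonempty_range_add_one fun k => f k ω
  have hF : Measurable F := Finset.measurable_range_sup'' fun k _ => hmeas k
  have hF0 : 0 ≤ F := fun ω =>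
    (hf0 n ω).trans (Finset.le_sup' (fun k => f k ω) (Finset.self_mem_range_succ n))
  have hFq : MemLp F (ENNReal.ofReal q) μ := by
    refine (memLp_finsetSum _ hmemLp).mono' hF.aestronglyMeasurable (.of_forall fun ω => ?_)
    rw [Real.norm_of_nonneg (hF0 ω)]
    exact Finset.sup'_le _ _ fun k hk =>
      Finset.single_le_sum (f := fun k => f k ω) (fun i _ => hf0 i ω) hk
  refine eLpNorm_le_of_mul_meas_ge_le_setLIntegral hq hF hF0 hFq hfn.1 fun t ht => ?_
  lift t to ℝ≥0 using ht.le
  have h := maximal_ineq hsub hf0 (ε := t) n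
  rw [ofReal_integral_eq_lintegral_ofReal (hsub.integrable n).integrableOn
    (.of_forall (hf0 n))] at h
  simpa only [ENNReal.ofReal_coe_nnreal, Real.enorm_of_nonneg (hf0 n _)] using h

theorem eLpNorm_iSup_enorm_le_of_norm_le_condExp {E : Type*} [SeminormedAddGroup E] (hq : 1 < q)
    {x : ℕ → Ω → E} {g : Ω → ℝ} {n : ℕ} (hg : MemLp g (ENNReal.ofReal q) μ)
    (hx : ∀ k ≤ n, ∀ᵐ ω ∂μ, ‖x k ω‖ ≤ (μ[g | 𝒢 k]) ω) :
    eLpNorm (fun ω => ⨆ k ≤ n, ‖x k ω‖ₑ) (ENNReal.ofReal q) μ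
      ≤ ENNReal.ofReal (q / (q - 1)) * eLpNorm g (ENNReal.ofReal q) μ := by
  have hq1 : 1 ≤ ENNReal.ofReal q := by simpa using hq.le
  set f : ℕ → Ω → ℝ := (fun k => μ[g | 𝒢 k])⁺
  have hsub : Submartingale f 𝒢 μ := (martingale_condExp g 𝒢 μ).submartingale.pos
  have hf0 : 0 ≤ f := fun k ω => le_max_right _ _
  calc eLpNorm (fun ω => ⨆ k ≤ n, ‖x k ω‖ₑ) (ENNReal.ofReal q) μ
      ≤ eLpNorm (fun ω => (Finset.range (n + 1)).sup' Finset.nonempty_range_add_one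
          fun k => f k ω) (ENNReal.ofReal q) μ := by
        refine eLpNorm_mono_enorm_ae ?_
        filter_upwards [(ae_ball_iff (Set.to_countable {k | k ≤ n})).2 hx] with ω hω
        rw [enorm_eq_self]
        refine iSup₂_le fun k hk => ?_
        rw [← ofReal_norm]
        refine (ENNReal.ofReal_le_ofReal ?_).trans (Real.ofReal_le_enorm _)
        calc ‖x k ω‖ ≤ f k ω := (hω k hk).trans (le_max_left _ _)
          _ ≤ _ := Finset.le_sup' (fun k => f k ω) (Finset.mem_range_succ_iff.2 hk)
    _ ≤ ENNReal.ofReal (q / (q - 1)) * eLpNorm (f n) (ENNReal.ofReal q) μ :=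
        eLpNorm_sup'_le_of_submartingale hq hsub hf0 (hg.condExp hq1).pos_part
    _ ≤ ENNReal.ofReal (q / (q - 1)) * eLpNorm g (ENNReal.ofReal q) μ := by
        gcongr
        refine (eLpNorm_mono fun ω => ?_).trans (eLpNorm_condExp_le_eLpNorm (m := 𝒢 n) g hq1)
        rw [Real.norm_of_nonneg (hf0 n ω)]
        exact max_le (le_abs_self _) (norm_nonneg _)

end Doob

section ConditionalIncrements

variable {Ω : Type*} {m : MeasurableSpace Ω} {μ : Measure Ω} {E : Type*} [NormedAddCommGroup E]
  [NormedSpace ℝ E] {ι : Type*} [Preorder ι] {ℱ : Filtration ι m} {X : ι → Ω → E} {s t u : ι}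

/-- The conditional increment `E(X_t | ℱ_s) - X_s` of a process, which vanishes for martingales. -/
noncomputable def condIncrement (μ : Measure Ω) (ℱ : Filtration ι m) (X : ι → Ω → E) (s t : ι) :
    Ω → E :=
  μ[X t | ℱ s] - X s

theorem stronglyMeasurable_condIncrement (hs : StronglyMeasurable[ℱ s] (X s)) :
    StronglyMeasurable[ℱ s] (condIncrement μ ℱ X s t) :=
  stronglyMeasurable_condExp.sub hs

theorem condIncrement_self [SigmaFiniteFiltration μ ℱ] (hs : StronglyMeasurable[ℱ s] (X s))
    (hsi : Integrable (X s) μ) :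
    condIncrement μ ℱ X s s = 0 := by
  rw [condIncrement, condExp_of_stronglyMeasurable (ℱ.le s) hs hsi, sub_self]

theorem norm_condIncrement_self_le_condExp [SigmaFiniteFiltration μ ℱ]
    (hs : StronglyMeasurable[ℱ s] (X s)) (hsi : Integrable (X s) μ) {S : Ω → ℝ} (hS : 0 ≤ S) :
    ∀ᵐ ω ∂μ, ‖condIncrement μ ℱ X s s ω‖ ≤ (μ[S | ℱ s]) ω := by
  rw [condIncrement_self hs hsi]
  filter_upwards [condExp_nonneg (m := ℱ s) (.of_forall hS)] with ω hω
  simpa using hω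

variable [CompleteSpace E]

theorem integrable_condIncrement (hs : Integrable (X s) μ) :
    Integrable (condIncrement μ ℱ X s t) μ :=
  integrable_condExp.sub hs

theorem norm_le_condExp_norm_add (ht : Integrable (X t) μ) {S : Ω → ℝ} (hS : Integrable S μ)
    (hle : ∀ᵐ ω ∂μ, ‖condIncrement μ ℱ X s t ω‖ ≤ (μ[S | ℱ s]) ω) :
    ∀ᵐ ω ∂μ, ‖X s ω‖ ≤ (μ[(fun ω => ‖X t ω‖) + S | ℱ s]) ω := by
  filter_upwards [hle, norm_condExp_le (m := ℱ s) (X t), condExp_add ht.norm hS (ℱ s)]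
    with ω hle hjensen hadd
  rw [hadd, Pi.add_apply]
  exact (norm_le_norm_add_norm_sub _ _).trans (add_le_add hjensen hle)

variable [SigmaFiniteFiltration μ ℱ]

theorem norm_condIncrement_le_condExp (hs : StronglyMeasurable[ℱ s] (X s))
    (hsi : Integrable (X s) μ) {V : Ω → ℝ} (hV : Integrable V μ)
    (hle : ∀ᵐ ω ∂μ, ‖condIncrement μ ℱ X s t ω‖ ≤ V ω) :
    ∀ᵐ ω ∂μ, ‖condIncrement μ ℱ X s t ω‖ ≤ (μ[V | ℱ s]) ω := by
  have hint := (integrable_condIncrement (ℱ := ℱ) (t := t) hsi).norm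
  have h := condExp_mono (m := ℱ s) hint hV hle
  rwa [condExp_of_stronglyMeasurable (ℱ.le s) (stronglyMeasurable_condIncrement hs).norm hint] at h

theorem condIncrement_ae_eq_condExp_add (hst : s ≤ t) (hti : Integrable (X t) μ) :
    condIncrement μ ℱ X s u
      =ᵐ[μ] μ[condIncrement μ ℱ X t u | ℱ s] + condIncrement μ ℱ X s t := by
  have tower := condExp_condExp_of_le (μ := μ) (f := X u) (ℱ.mono hst) (ℱ.le t)
  have hsub := condExp_sub (integrable_condExp (m := ℱ t) (f := X u)) hti (ℱ s)
  filter_upwards [tower, hsub] with ω htower hsub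
  simp only [condIncrement, Pi.add_apply, Pi.sub_apply, htower] at hsub ⊢
  rw [hsub, sub_add_sub_cancel]

theorem norm_condIncrement_le_condExp_add (hst : s ≤ t) (hs : StronglyMeasurable[ℱ s] (X s))
    (hsi : Integrable (X s) μ) (hti : Integrable (X t) μ) {S V : Ω → ℝ} (hS : Integrable S μ)
    (hV : Integrable V μ) (hstV : ∀ᵐ ω ∂μ, ‖condIncrement μ ℱ X s t ω‖ ≤ V ω)
    (htuS : ∀ᵐ ω ∂μ, ‖condIncrement μ ℱ X t u ω‖ ≤ (μ[S | ℱ t]) ω) :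
    ∀ᵐ ω ∂μ, ‖condIncrement μ ℱ X s u ω‖ ≤ (μ[S + V | ℱ s]) ω := by
  filter_upwards [condIncrement_ae_eq_condExp_add (ℱ := ℱ) (u := u) hst hti,
    norm_condExp_le (m := ℱ s) (condIncrement μ ℱ X t u),
    condExp_mono (m := ℱ s) (integrable_condIncrement (ℱ := ℱ) hti).norm integrable_condExp htuS,
    condExp_condExp_of_le (f := S) (ℱ.mono hst) (ℱ.le t),
    norm_condIncrement_le_condExp hs hsi hV hstV,
    condExp_add hS hV (ℱ s)] with ω hsplit hjensen hmono htower hV hadd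
  rw [hsplit, hadd, Pi.add_apply, Pi.add_apply, ← htower]
  exact (norm_add_le _ _).trans (add_le_add (hjensen.trans hmono) hV)

end ConditionalIncrements

/-- The `j`-th point of the subdivision of `[a, b]` into `2 ^ n` equal parts, for `j ≤ 2 ^ n`; only
meaningful for `a ≤ b`, as subtraction in `ℝ≥0` is truncated. -/
noncomputable def dyadicPoint (a b : ℝ≥0) (n j : ℕ) : ℝ≥0 :=
  a + j / 2 ^ n * (b - a)

namespace dyadicPoint

variable {a b : ℝ≥0}

theorem monotone (a b : ℝ≥0) (n : ℕ) : Monotone (dyadicPoint a b n) := fun i j hij => by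
  unfold dyadicPoint
  gcongr

theorem two_pow (hab : a ≤ b) (n : ℕ) : dyadicPoint a b n (2 ^ n) = b := by
  simp [dyadicPoint, add_tsub_cancel_of_le hab]

theorem mem_Icc (hab : a ≤ b) {n j : ℕ} (hj : j ≤ 2 ^ n) : dyadicPoint a b n j ∈ Set.Icc a b :=
  ⟨le_self_add, (monotone a b n hj).trans_eq (two_pow hab n)⟩

theorem succ_two_mul (a b : ℝ≥0) (n j : ℕ) :
    dyadicPoint a b (n + 1) (2 * j) = dyadicPoint a b n j := by
  simp only [dyadicPoint, Nat.cast_mul, Nat.cast_ofNat, pow_succ']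
  rw [mul_div_mul_left _ _ two_ne_zero]

theorem strictMono (hab : a < b) (n : ℕ) : StrictMono (dyadicPoint a b n) := fun i j hij => by
  have : 0 < b - a := tsub_pos_of_lt hab
  unfold dyadicPoint
  gcongr

theorem coe_succ_sub (hab : a ≤ b) (n j : ℕ) :
    (dyadicPoint a b n (j + 1) : ℝ) - dyadicPoint a b n j = (b - a) / 2 ^ n := by
  simp only [dyadicPoint]
  push_cast [NNReal.coe_sub hab]
  ring

open Filter Topology in
theorem exists_tendsto_of_mem_Icc (hab : a < b) {u : ℝ≥0} (hu : u ∈ Set.Icc a b) :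
    ∃ j : ℕ → ℕ, (∀ n, j n ≤ 2 ^ n) ∧ (∀ n, u ≤ dyadicPoint a b n (j n)) ∧
      Tendsto (fun n => dyadicPoint a b n (j n)) atTop (𝓝 u) := by
  set x : ℝ≥0 := (u - a) / (b - a)
  have hx1 : x ≤ 1 := div_le_one_of_le₀ (tsub_le_tsub_right hu.2 a) zero_le
  have hxu : a + x * (b - a) = u := by
    rw [div_mul_cancel₀ _ (tsub_pos_of_lt hab).ne', add_tsub_cancel_of_le hu.1]
  refine ⟨fun n => ⌈(x : ℝ) * 2 ^ n⌉₊, fun n => ?_, fun n => ?_, ?_⟩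
  · refine Nat.ceil_le.2 ?_
    push_cast
    exact mul_le_of_le_one_left (by positivity) (by exact_mod_cast hx1)
  · rw [← hxu]
    unfold dyadicPoint
    gcongr
    rw [le_div_iff₀ (by positivity)]
    exact_mod_cast Nat.le_ceil ((x : ℝ) * 2 ^ n)
  · have hlim : Tendsto (fun n : ℕ => (⌈(x : ℝ) * 2 ^ n⌉₊ : ℝ≥0) / 2 ^ n) atTop (𝓝 x) := by
      rw [← NNReal.tendsto_coe]
      push_cast
      exact (tendsto_nat_ceil_mul_div_atTop x.coe_nonneg).comp
        (tendsto_pow_atTop_atTop_of_one_lt (one_lt_two (α := ℝ)))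
    rw [← hxu]
    exact (hlim.mul_const (b - a)).const_add a

end dyadicPoint

section DyadicSup

variable {α : Type*} [CompleteLattice α] {a b : ℝ≥0} {f : ℝ≥0 → α}

/-- The supremum of `f` over the points of the `n`-th dyadic subdivision of `[a, b]`, which
approximates its supremum over `[a, b]`. -/
noncomputable def dyadicSup (a b : ℝ≥0) (f : ℝ≥0 → α) (n : ℕ) : α :=
  ⨆ j ≤ 2 ^ n, f (dyadicPoint a b n j)

theorem le_dyadicSup {n j : ℕ} (hj : j ≤ 2 ^ n) : f (dyadicPoint a b n j) ≤ dyadicSup a b f n :=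
  le_iSup₂ (f := fun j (_ : j ≤ 2 ^ n) => f (dyadicPoint a b n j)) j hj

theorem monotone_dyadicSup (a b : ℝ≥0) (f : ℝ≥0 → α) : Monotone (dyadicSup a b f) := by
  refine monotone_nat_of_le_succ fun n => iSup₂_le fun j hj => ?_
  rw [← dyadicPoint.succ_two_mul]
  exact le_dyadicSup (by omega)

theorem iSup_Icc_eq_iSup_dyadicSup [TopologicalSpace α] [ClosedIicTopology α] (hab : a < b)
    (hf : ∀ u ∈ Set.Icc a b, ContinuousWithinAt f (Set.Icc u b) u) :
    ⨆ u ∈ Set.Icc a b, f u = ⨆ n, dyadicSup a b f n := by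
  refine le_antisymm (iSup₂_le fun u hu => ?_) (iSup_le fun n => iSup₂_le fun j hj => ?_)
  · obtain ⟨j, hj, huj, hlim⟩ := dyadicPoint.exists_tendsto_of_mem_Icc hab hu
    have hlim_within := (hf u hu).tendsto.comp (tendsto_nhdsWithin_iff.2
      ⟨hlim, .of_forall fun n => ⟨huj n, (dyadicPoint.mem_Icc hab.le (hj n)).2⟩⟩)
    exact le_of_tendsto' hlim_within fun n => (le_dyadicSup (hj n)).trans (le_iSup _ n)
  · exact le_iSup₂ (f := fun u (_ : u ∈ Set.Icc a b) => f u) _ (dyadicPoint.mem_Icc hab.le hj)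

end DyadicSup

section LpSum

theorem norm_le_rpow_sum_norm_rpow {ι E : Type*} [SeminormedAddGroup E] {p : ℝ} (hp : 0 < p)
    {s : Finset ι} (x : ι → E) {i : ι} (hi : i ∈ s) :
    ‖x i‖ ≤ (∑ j ∈ s, ‖x j‖ ^ p) ^ (1 / p) := by
  rw [one_div, Real.le_rpow_inv_iff_of_pos (norm_nonneg _) (by positivity) hp]
  exact Finset.single_le_sum (f := fun j => ‖x j‖ ^ p) (fun j _ => by positivity) hi

theorem eLpNorm_rpow_sum_norm_rpow {Ω ι E : Type*} {m : MeasurableSpace Ω} {μ : Measure Ω}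
    [SeminormedAddGroup E] {p : ℝ} (hp : 0 < p) {s : Finset ι} {u : ι → Ω → E}
    (hu : ∀ j ∈ s, AEStronglyMeasurable (u j) μ) :
    eLpNorm (fun ω => (∑ j ∈ s, ‖u j ω‖ ^ p) ^ (1 / p)) (ENNReal.ofReal p) μ
      = (∑ j ∈ s, ∫⁻ ω, ‖u j ω‖ₑ ^ p ∂μ) ^ (1 / p) := by
  have hpoint : ∀ ω, ‖(∑ j ∈ s, ‖u j ω‖ ^ p) ^ (1 / p)‖ₑ ^ p = ∑ j ∈ s, ‖u j ω‖ₑ ^ p := fun ω => by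
    have hsum : 0 ≤ ∑ j ∈ s, ‖u j ω‖ ^ p := by positivity
    rw [Real.enorm_of_nonneg (by positivity), ENNReal.ofReal_rpow_of_nonneg (by positivity) hp.le,
      ← Real.rpow_mul hsum, one_div_mul_cancel hp.ne', Real.rpow_one,
      ENNReal.ofReal_sum_of_nonneg fun j _ => by positivity]
    refine Finset.sum_congr rfl fun j _ => ?_
    rw [← ENNReal.ofReal_rpow_of_nonneg (norm_nonneg _) hp.le, ofReal_norm]
  rw [eLpNorm_ofReal_eq_lintegral_rpow_enorm hp]
  simp_rw [hpoint]
  rw [lintegral_finsetSum' _ fun j hj => (hu j hj).enorm.pow_const _]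

end LpSum

section MaximalConst

variable {p h : ℝ}

/-- The constant `C_{p,h}`: the `p`-th power of the sum of the geometric series with ratio
`2 ^ (1 / p - h)`, the factor gained from each dyadic level to the next. -/
noncomputable def maximalConst (p h : ℝ) : ℝ :=
  (1 - 2 ^ (1 / p - h))⁻¹ ^ p

theorem two_rpow_one_div_sub_lt_one (hp : 0 < p) (hph : 1 < p * h) : (2 : ℝ) ^ (1 / p - h) < 1 := by
  refine Real.rpow_lt_one_of_one_lt_of_neg one_lt_two (sub_neg.2 ?_)
  rwa [div_lt_iff₀ hp, mul_comm]

theorem maximalConst_pos (hp : 0 < p) (hph : 1 < p * h) : 0 < maximalConst p h :=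
  Real.rpow_pos_of_pos (inv_pos.2 (sub_pos.2 (two_rpow_one_div_sub_lt_one hp hph))) p

theorem sum_geometric_le_maximalConst_rpow (hp : 0 < p) (hph : 1 < p * h) (n : ℕ) :
    ∑ k ∈ Finset.range n, ((2 : ℝ) ^ (1 / p - h)) ^ k ≤ maximalConst p h ^ (1 / p) := by
  have hr0 : (0 : ℝ) ≤ 2 ^ (1 / p - h) := by positivity
  have hr1 := two_rpow_one_div_sub_lt_one hp hph
  rw [maximalConst, ← Real.rpow_mul (inv_nonneg.2 (sub_nonneg.2 hr1.le)),
    mul_one_div_cancel hp.ne', Real.rpow_one, ← tsum_geometric_of_lt_one hr0 hr1]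
  exact (summable_geometric_of_lt_one hr0 hr1).sum_le_tsum _ fun _ _ => by positivity

theorem two_pow_mul_rpow_eq {A L : ℝ} (hp : 0 < p) (hA : 0 ≤ A) (hL : 0 ≤ L) (n : ℕ) :
    (2 ^ n * (A * (L / 2 ^ n) ^ (p * h))) ^ (1 / p)
      = (2 ^ (1 / p - h)) ^ n * (A ^ (1 / p) * L ^ h) := by
  rw [Real.mul_rpow (by positivity) (by positivity), Real.mul_rpow hA (by positivity),
    ← Real.rpow_mul (by positivity), mul_right_comm p h, mul_one_div_cancel hp.ne', one_mul,
    Real.div_rpow hL (by positivity), ← Real.rpow_natCast, ← Real.rpow_natCast,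
    ← Real.rpow_mul zero_le_two, ← Real.rpow_mul zero_le_two, ← Real.rpow_mul zero_le_two,
    sub_mul, Real.rpow_sub zero_lt_two, mul_comm (n : ℝ) (1 / p), mul_comm (n : ℝ) h]
  ring

end MaximalConst

section Chaining

variable {Ω : Type*} {m : MeasurableSpace Ω} {P : Measure Ω} {ℱ : Filtration ℝ≥0 m}
  {E : Type*} [NormedAddCommGroup E] [NormedSpace ℝ E] {X : ℝ≥0 → Ω → E} {a b : ℝ≥0}

/-- An odd point of level `n + 1` is one step away from a point of level `n`, so going from level
`n` to level `n + 1` costs a single increment, bounded by `V (n + 1)`. -/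
theorem norm_condIncrement_dyadicPoint_le [CompleteSpace E] [SigmaFiniteFiltration P ℱ]
    (hab : a ≤ b) (hX : ∀ t ∈ Set.Icc a b, StronglyMeasurable[ℱ t] (X t))
    (hXi : ∀ t ∈ Set.Icc a b, Integrable (X t) P) {V : ℕ → Ω → ℝ} (hV : ∀ n, Integrable (V n) P)
    (hV0 : ∀ n, 0 ≤ V n)
    (hincr : ∀ n, ∀ j < 2 ^ n, ∀ᵐ ω ∂P,
      ‖condIncrement P ℱ X (dyadicPoint a b n j) (dyadicPoint a b n (j + 1)) ω‖ ≤ V n ω)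
    (n : ℕ) {j : ℕ} (hj : j ≤ 2 ^ n) :
    ∀ᵐ ω ∂P, ‖condIncrement P ℱ X (dyadicPoint a b n j) b ω‖ ≤
      (P[∑ k ∈ Finset.range (n + 1), V k | ℱ (dyadicPoint a b n j)]) ω := by
  have hSi : ∀ n, Integrable (∑ k ∈ Finset.range n, V k) P :=
    fun n => integrable_finsetSum' _ fun k _ => hV k
  have at_right : ∀ n, ∀ᵐ ω ∂P, ‖condIncrement P ℱ X b b ω‖ ≤
      (P[∑ k ∈ Finset.range n, V k | ℱ b]) ω := fun n =>
    norm_condIncrement_self_le_condExp (hX b (Set.right_mem_Icc.2 hab))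
      (hXi b (Set.right_mem_Icc.2 hab)) (Finset.sum_nonneg fun k _ => hV0 k)
  have step_right : ∀ {n j}, j < 2 ^ n →
      (∀ᵐ ω ∂P, ‖condIncrement P ℱ X (dyadicPoint a b n (j + 1)) b ω‖ ≤
        (P[∑ k ∈ Finset.range n, V k | ℱ (dyadicPoint a b n (j + 1))]) ω) →
      ∀ᵐ ω ∂P, ‖condIncrement P ℱ X (dyadicPoint a b n j) b ω‖ ≤
        (P[∑ k ∈ Finset.range (n + 1), V k | ℱ (dyadicPoint a b n j)]) ω := by
    intro n j hj hnext
    have hmem := dyadicPoint.mem_Icc hab hj.le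
    rw [Finset.sum_range_succ]
    exact norm_condIncrement_le_condExp_add (dyadicPoint.monotone a b n j.le_succ) (hX _ hmem)
      (hXi _ hmem) (hXi _ (dyadicPoint.mem_Icc hab hj)) (hSi n) (hV n) (hincr n j hj) hnext
  induction n generalizing j with
  | zero =>
    obtain rfl | rfl : j = 0 ∨ j = 2 ^ 0 := by rw [pow_zero] at *; omega
    · refine step_right (by simp) ?_
      rw [show 0 + 1 = 2 ^ 0 by rfl, dyadicPoint.two_pow hab]
      exact at_right 0
    · rw [dyadicPoint.two_pow hab]
      exact at_right _
  | succ n ih =>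
    obtain ⟨i, rfl | rfl⟩ := Nat.even_or_odd' j
    · rw [dyadicPoint.succ_two_mul]
      have hmono := condExp_mono (m := ℱ (dyadicPoint a b n i)) (hSi (n + 1)) (hSi (n + 1 + 1))
        (.of_forall (by
          rw [Finset.sum_range_succ _ (n + 1)]
          exact le_add_of_nonneg_right (hV0 _)))
      filter_upwards [ih (j := i) (by omega), hmono] with ω h_level h_mono
      exact h_level.trans h_mono
    · refine step_right (by omega) ?_
      rw [show 2 * i + 1 + 1 = 2 * (i + 1) by ring, dyadicPoint.succ_two_mul]
      exact ih (j := i + 1) (by omega)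

/-- The `ℓ^p` norm of the conditional increments along the `n`-th dyadic subdivision of `[a, b]`,
used as a common bound for them whose `L^p` norm is computable. -/
noncomputable def condVariation (P : Measure Ω) (ℱ : Filtration ℝ≥0 m) (X : ℝ≥0 → Ω → E)
    (a b : ℝ≥0) (p : ℝ) (n : ℕ) (ω : Ω) : ℝ :=
  (∑ j ∈ Finset.range (2 ^ n),
    ‖condIncrement P ℱ X (dyadicPoint a b n j) (dyadicPoint a b n (j + 1)) ω‖ ^ p) ^ (1 / p)

theorem condVariation_nonneg (p : ℝ) (n : ℕ) : 0 ≤ condVariation P ℱ X a b p n := fun _ =>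
  Real.rpow_nonneg (Finset.sum_nonneg fun _ _ => Real.rpow_nonneg (norm_nonneg _) _) _

theorem norm_condIncrement_le_condVariation {p : ℝ} (hp : 0 < p) {n j : ℕ} (hj : j < 2 ^ n)
    (ω : Ω) : ‖condIncrement P ℱ X (dyadicPoint a b n j) (dyadicPoint a b n (j + 1)) ω‖ ≤
      condVariation P ℱ X a b p n ω :=
  norm_le_rpow_sum_norm_rpow hp (fun j => condIncrement P ℱ X (dyadicPoint a b n j)
    (dyadicPoint a b n (j + 1)) ω) (Finset.mem_range.2 hj)

theorem stronglyMeasurable_condIncrement_dyadicPoint (hab : a ≤ b)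
    (hX : ∀ t ∈ Set.Icc a b, StronglyMeasurable[ℱ t] (X t)) {n j : ℕ} (hj : j < 2 ^ n) (t : ℝ≥0) :
    StronglyMeasurable (condIncrement P ℱ X (dyadicPoint a b n j) t) :=
  (stronglyMeasurable_condIncrement (hX _ (dyadicPoint.mem_Icc hab hj.le))).mono (ℱ.le _)

theorem measurable_condVariation (hab : a ≤ b)
    (hX : ∀ t ∈ Set.Icc a b, StronglyMeasurable[ℱ t] (X t)) (p : ℝ) (n : ℕ) :
    Measurable (condVariation P ℱ X a b p n) :=
  (Finset.measurable_fun_sum _ fun _ hj => (stronglyMeasurable_condIncrement_dyadicPoint hab hX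
    (Finset.mem_range.1 hj) _).norm.measurable.pow_const p).pow_const _

/-- The analogue on `[a, b]`, for processes with values in a normed space, of the adaptedness and
of the bound in `ConditionalIncrementControl`. -/
structure CondIncrementControlOn (P : Measure Ω) (ℱ : Filtration ℝ≥0 m) (X : ℝ≥0 → Ω → E)
    (a b : ℝ≥0) (p h A : ℝ) : Prop where
  adapted : ∀ t ∈ Set.Icc a b, StronglyMeasurable[ℱ t] (X t)
  nonneg : 0 ≤ A
  bound : ∀ s t : ℝ≥0, a ≤ s → s < t → t ≤ b →
    ∫⁻ ω, ‖condIncrement P ℱ X s t ω‖ₑ ^ p ∂P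
      ≤ ENNReal.ofReal (A * |(t : ℝ) - (s : ℝ)| ^ (p * h))

variable {p q h A : ℝ}

theorem eLpNorm_condVariation_le (hp : 0 < p) (hab : a < b)
    (hX : CondIncrementControlOn P ℱ X a b p h A) (n : ℕ) :
    eLpNorm (condVariation P ℱ X a b p n) (ENNReal.ofReal p) P
      ≤ ENNReal.ofReal ((2 ^ (1 / p - h)) ^ n * (A ^ (1 / p) * |(b : ℝ) - (a : ℝ)| ^ h)) := by
  have hlevel : ∀ j ∈ Finset.range (2 ^ n),
      ∫⁻ ω, ‖condIncrement P ℱ X (dyadicPoint a b n j) (dyadicPoint a b n (j + 1)) ω‖ₑ ^ p ∂P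
        ≤ ENNReal.ofReal (A * (|(b : ℝ) - a| / 2 ^ n) ^ (p * h)) := fun j hj => by
    have hj := Finset.mem_range.1 hj
    refine (hX.bound _ _ (dyadicPoint.mem_Icc hab.le hj.le).1 (dyadicPoint.strictMono hab n
      j.lt_succ_self) (dyadicPoint.mem_Icc hab.le hj).2).trans_eq ?_
    rw [dyadicPoint.coe_succ_sub hab.le, abs_div, abs_of_pos (by positivity : (0 : ℝ) < 2 ^ n)]
  have hA := hX.nonneg
  calc eLpNorm (condVariation P ℱ X a b p n) (ENNReal.ofReal p) P
      = (∑ j ∈ Finset.range (2 ^ n), ∫⁻ ω, ‖condIncrement P ℱ X (dyadicPoint a b n j)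
          (dyadicPoint a b n (j + 1)) ω‖ₑ ^ p ∂P) ^ (1 / p) :=
        eLpNorm_rpow_sum_norm_rpow hp fun j hj => (stronglyMeasurable_condIncrement_dyadicPoint
          hab.le hX.adapted (Finset.mem_range.1 hj) _).aestronglyMeasurable
    _ ≤ (2 ^ n * ENNReal.ofReal (A * (|(b : ℝ) - a| / 2 ^ n) ^ (p * h))) ^ (1 / p) := by
        gcongr
        simpa using Finset.sum_le_card_nsmul _ _ _ hlevel
    _ = ENNReal.ofReal ((2 ^ n * (A * (|(b : ℝ) - a| / 2 ^ n) ^ (p * h))) ^ (1 / p)) := by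
        rw [← ENNReal.ofReal_rpow_of_nonneg (by positivity) (by positivity),
          ENNReal.ofReal_mul (p := 2 ^ n) (by positivity), ENNReal.ofReal_pow zero_le_two,
          ENNReal.ofReal_ofNat]
    _ = _ := by rw [two_pow_mul_rpow_eq hp hA (abs_nonneg _)]

theorem memLp_condVariation (hp : 0 < p) (hab : a < b)
    (hX : CondIncrementControlOn P ℱ X a b p h A) (n : ℕ) :
    MemLp (condVariation P ℱ X a b p n) (ENNReal.ofReal p) P :=
  ⟨(measurable_condVariation hab.le hX.adapted p n).aestronglyMeasurable,
    (eLpNorm_condVariation_le hp hab hX n).trans_lt ENNReal.ofReal_lt_top⟩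

theorem eLpNorm_sum_condVariation_le (hp : 1 ≤ p) (hph : 1 < p * h) (hab : a < b)
    (hX : CondIncrementControlOn P ℱ X a b p h A) (n : ℕ) :
    eLpNorm (∑ k ∈ Finset.range n, condVariation P ℱ X a b p k) (ENNReal.ofReal p) P
      ≤ ENNReal.ofReal (maximalConst p h ^ (1 / p) * A ^ (1 / p) * |(b : ℝ) - (a : ℝ)| ^ h) := by
  have hp0 : 0 < p := by linarith
  have hA := hX.nonneg
  calc eLpNorm (∑ k ∈ Finset.range n, condVariation P ℱ X a b p k) (ENNReal.ofReal p) P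
      ≤ ∑ k ∈ Finset.range n, eLpNorm (condVariation P ℱ X a b p k) (ENNReal.ofReal p) P :=
        eLpNorm_sum_le (fun k _ => (memLp_condVariation hp0 hab hX k).1) (by simpa using hp)
    _ ≤ ∑ k ∈ Finset.range n, ENNReal.ofReal
          ((2 ^ (1 / p - h)) ^ k * (A ^ (1 / p) * |(b : ℝ) - (a : ℝ)| ^ h)) := by
        gcongr with k
        exact eLpNorm_condVariation_le hp0 hab hX k
    _ = ENNReal.ofReal ((∑ k ∈ Finset.range n, (2 ^ (1 / p - h)) ^ k) *
          (A ^ (1 / p) * |(b : ℝ) - (a : ℝ)| ^ h)) := by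
        rw [← ENNReal.ofReal_sum_of_nonneg fun _ _ => by positivity, Finset.sum_mul]
    _ ≤ _ := by
        rw [mul_assoc]
        gcongr
        exact sum_geometric_le_maximalConst_rpow hp0 hph n

variable [CompleteSpace E]

theorem norm_dyadicPoint_le_condExp [IsFiniteMeasure P] (hp : 1 ≤ p) (hab : a < b)
    (hX : CondIncrementControlOn P ℱ X a b p h A)
    (hXi : ∀ t ∈ Set.Icc a b, Integrable (X t) P) (n : ℕ) {j : ℕ} (hj : j ≤ 2 ^ n) :
    ∀ᵐ ω ∂P, ‖X (dyadicPoint a b n j) ω‖ ≤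
      (P[(fun ω => ‖X b ω‖) + ∑ k ∈ Finset.range (n + 1), condVariation P ℱ X a b p k |
        ℱ (dyadicPoint a b n j)]) ω := by
  have hp0 : 0 < p := by linarith
  have hVi : ∀ k, Integrable (condVariation P ℱ X a b p k) P := fun k =>
    (memLp_condVariation hp0 hab hX k).integrable (by simpa using hp)
  refine norm_le_condExp_norm_add (hXi b (Set.right_mem_Icc.2 hab.le))
    (integrable_finsetSum' _ fun k _ => hVi k) ?_
  exact norm_condIncrement_dyadicPoint_le hab.le hX.adapted hXi hVi (condVariation_nonneg p)
    (fun k i hi => .of_forall (norm_condIncrement_le_condVariation hp0 hi)) n hj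

variable [IsProbabilityMeasure P]

theorem eLpNorm_dyadicSup_le (hph : 1 < p * h) (hq : 1 < q) (hqp : q ≤ p) (hab : a < b)
    (hX : CondIncrementControlOn P ℱ X a b p h A)
    (hXp : ∀ t ∈ Set.Icc a b, MemLp (X t) (ENNReal.ofReal p) P) (n : ℕ) :
    eLpNorm (fun ω => dyadicSup a b (fun t => ‖X t ω‖ₑ) n) (ENNReal.ofReal q) P
      ≤ ENNReal.ofReal (q / (q - 1)) *
        (ENNReal.ofReal (maximalConst p h ^ (1 / p) * A ^ (1 / p) * |(b : ℝ) - (a : ℝ)| ^ h)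
          + eLpNorm (X b) (ENNReal.ofReal q) P) := by
  have hp : 1 < p := hq.trans_le hqp
  have hp0 : 0 < p := by linarith
  have hq1 : 1 ≤ ENNReal.ofReal q := by simpa using hq.le
  have hqp' : ENNReal.ofReal q ≤ ENNReal.ofReal p := ENNReal.ofReal_le_ofReal hqp
  have hb := hXp b (Set.right_mem_Icc.2 hab.le)
  set S : Ω → ℝ := ∑ k ∈ Finset.range (n + 1), condVariation P ℱ X a b p k
  have hS : MemLp S (ENNReal.ofReal p) P :=
    memLp_finsetSum' _ fun k _ => memLp_condVariation hp0 hab hX k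
  let 𝒢 : Filtration ℕ m := ⟨fun j => ℱ (dyadicPoint a b n j),
    fun i j hij => ℱ.mono (dyadicPoint.monotone a b n hij), fun j => ℱ.le _⟩
  calc eLpNorm (fun ω => dyadicSup a b (fun t => ‖X t ω‖ₑ) n) (ENNReal.ofReal q) P
      ≤ ENNReal.ofReal (q / (q - 1)) *
          eLpNorm ((fun ω => ‖X b ω‖) + S) (ENNReal.ofReal q) P :=
        eLpNorm_iSup_enorm_le_of_norm_le_condExp (𝒢 := 𝒢) hq
          ((hb.norm.add hS).mono_exponent hqp') fun j hj => norm_dyadicPoint_le_condExp hp.le hab hX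
            (fun t ht => (hXp t ht).integrable (hq1.trans hqp')) n hj
    _ ≤ ENNReal.ofReal (q / (q - 1)) * (eLpNorm (X b) (ENNReal.ofReal q) P +
          eLpNorm S (ENNReal.ofReal p) P) := by
        gcongr
        refine (eLpNorm_add_le hb.1.norm hS.1 hq1).trans ?_
        rw [eLpNorm_norm]
        gcongr
        exact eLpNorm_le_eLpNorm_of_exponent_le hqp' hS.1
    _ ≤ _ := by
        rw [add_comm]
        gcongr
        exact eLpNorm_sum_condVariation_le hp.le hph hab hX (n + 1)

theorem theorem1_general (hph : 1 < p * h) (hq : 1 < q) (hqp : q ≤ p) (hab : a < b)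
    (hX : CondIncrementControlOn P ℱ X a b p h A)
    (hXp : ∀ t ∈ Set.Icc a b, MemLp (X t) (ENNReal.ofReal p) P)
    (hcont : ∀ᵐ ω ∂P, ∀ u ∈ Set.Icc a b, ContinuousWithinAt (fun t => X t ω) (Set.Icc u b) u) :
    AEMeasurable (fun ω => ⨆ u ∈ Set.Icc a b, ‖X u ω‖ₑ) P ∧
      eLpNorm (fun ω => ⨆ u ∈ Set.Icc a b, ‖X u ω‖ₑ) (ENNReal.ofReal q) P
        ≤ ENNReal.ofReal (q / (q - 1)) *
          (ENNReal.ofReal (maximalConst p h ^ (1 / p) * A ^ (1 / p) * |(b : ℝ) - (a : ℝ)| ^ h)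
            + eLpNorm (X b) (ENNReal.ofReal q) P) := by
  have hmeas : ∀ n, Measurable fun ω => dyadicSup a b (fun t => ‖X t ω‖ₑ) n := fun n =>
    .iSup fun j => .iSup fun hj =>
      ((hX.adapted _ (dyadicPoint.mem_Icc hab.le hj)).mono (ℱ.le _)).enorm
  have hsup : (fun ω => ⨆ u ∈ Set.Icc a b, ‖X u ω‖ₑ)
      =ᵐ[P] fun ω => ⨆ n, dyadicSup a b (fun t => ‖X t ω‖ₑ) n := by
    filter_upwards [hcont] with ω hω
    exact iSup_Icc_eq_iSup_dyadicSup hab fun u hu => (hω u hu).enorm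
  refine ⟨(Measurable.iSup hmeas).aemeasurable.congr hsup.symm, ?_⟩
  rw [eLpNorm_congr_ae hsup, eLpNorm_iSup_of_monotone ENNReal.ofReal_ne_top
    (fun n => (hmeas n).aemeasurable) (.of_forall fun ω => monotone_dyadicSup a b _)]
  exact iSup_le (eLpNorm_dyadicSup_le hph hq hqp hab hX hXp)

end Chaining

theorem theorem1 (p h : ℝ) (hp : 1 < p) (hh_pos : 0 < h) (hh_le : h ≤ 1) (hph : 1 < p * h) :
    ∃ C : ℝ, 0 < C ∧
      ∀ (Ω : Type*) (m : MeasurableSpace Ω) (P : Measure Ω) (_ : IsProbabilityMeasure P)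
        (ℱ : Filtration ℝ≥0 m) (_ : UsualConditions P ℱ)
        (d : ℕ) (T : ℝ≥0) (X : ℝ≥0 → Ω → EuclideanSpace ℝ (Fin d)) (A : ℝ),
        IsContinuousAdapted P ℱ T X →
        ConditionalIncrementControl P ℱ T X p h A →
        ∀ s₀ t₀ : ℝ≥0, s₀ < t₀ → t₀ ≤ T →
        ∀ q : ℝ, 1 < q → q ≤ p →
          AEMeasurable (runningSup X s₀ t₀) P ∧
          eLpNorm (runningSup X s₀ t₀) (ENNReal.ofReal q) P
            ≤ ENNReal.ofReal (q / (q - 1)) *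
              (ENNReal.ofReal (C ^ (1 / p) * A ^ (1 / p) * |(t₀ : ℝ) - (s₀ : ℝ)| ^ h)
                + eLpNorm (X t₀) (ENNReal.ofReal q) P) := by
  refine ⟨maximalConst p h, maximalConst_pos (by linarith) hph, ?_⟩
  intro Ω m P _ ℱ _ d T X A hX hXA s₀ t₀ hst htT q hq hqp
  refine theorem1_general (ℱ := ℱ) hph hq hqp hst
    ⟨fun t ht => ?_, hXA.nonneg, fun s t _ hst ht => ?_⟩ (fun t ht => hXA.memLp t ?_) ?_
  · exact (hX.adapted t (ht.2.trans htT)).stronglyMeasurable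
  · exact hXA.bound s t hst (ht.trans htT)
  · exact ht.2.trans htT
  · exact hX.continuous.mono fun ω hω u hu =>
      (hω u ⟨zero_le, hu.2.trans htT⟩).mono (Set.Icc_subset_Icc zero_le htT)
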